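/- Setting. Nodes $a_1,a_2,\dots$ decide sequentially between $H_0$ and $H_1$, which have prior probabilities $\pi_0,\pi_1>0$, $\pi_0+\pi_1=1$. Under $H_j$ the private signals $X_1,X_2,\dots$ are i.i.d. with law $\mathbb P^X_j$ on a measurable space $(S,\mathcal S)$; $\mathbb P^X_0$ and $\mathbb P^X_1$ are equivalent, and the likelihood ratio $L_X=d\mathbb P^X_1/d\mathbb P^X_0$ is unbounded, i.e. $\inf_{S'}L_X=0$ and $\sup_{S'}L_X=\infty$ on every measurable $S'\subset S$ with $\tfrac12(\mathbb P^X_0+\mathbb P^X_1)(S')=1$. Node $a_k$ observes $X_k$ and the broadcasts $\hat d_{k-1},\dots,\hat d_{k-m_k}$ of its $m_k\le k-1$ immediate predecessors, and makes a decision $d_k\in\{0,1\}$ by a likelihood ratio test with a threshold $t_k>0$: $d_k=1$ if and only if $L_X(X_k)\,L^k_D(\hat d_{k-1},\dots,\hat d_{k-m_k})>t_k$, where $L_D^k(D)=\mathbb P_1(\hat d_{k-1},\dots,\hat d_{k-m_k}=D)/\mathbb P_0(\hat d_{k-1},\dots,\hat d_{k-m_k}=D)$. Its decision is broadcast through a memoryless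 erasure channel: given $d_k=j$, independently of everything else, $\hat d_k$ is the erasure symbol $e$ with probability $p_{k,j}=\mathbb P(\hat d_k=e\mid d_k=j)$ and $\hat d_k=j$ otherwise. A decision strategy is a sequence of thresholds $t_k>0$, and its error probability is $\mathbb P_e^k=\pi_0\mathbb P_0(d_k=1)+\pi_1\mathbb P_1(d_k=0)$. Let $n_k$ be the largest integer $n\ge 0$ with $k-n^2\ge 1$ such that each of the nodes $a_{k-n^2},\dots,a_k$ has a memory size of at least $n$. Theorem. Suppose that $m_k\to\infty$ and that, for some $\varepsilon>1$ and $c>0$, at least one of the following holds: (a) for all sufficiently large $k$, the $n_k$ immediate predecessors of $a_k$ satisfy $p_{i,j}\le (c\,n_k)^{-\varepsilon/n_k}$ for $k-n_k\le i\le k-1$ and $j=0,1$; (b) $p_{k,j}\le (c\,n_k)^{-\varepsilon/n_k}$ for all sufficiently large $k$ and $j=0,1$, and there is a constant $K$ such that for all sufficiently large $k$, $n_i\le K n_k$ for $k-n_k\le i\le k-1$ (for instance, $K=1$ if the memory sizes $m_k$ are non-decreasing). Then there is a decision strategy such that $\mathbb P_e^k\to 0$ as $k\to\infty$. In particular, the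 erasure probabilities may tend to $1$. -/

import Mathlib

open Filter Topology MeasureTheory
open scoped NNReal ENNReal

/-- The data of the sequential binary hypothesis testing problem with broadcast erasures.
`false` and `true` stand for the hypotheses `H₀`, `H₁` and for the decisions `0`, `1`.
The nodes are numbered `0, 1, 2, …`, so that node `k` has exactly `k` predecessors. -/
structure ErasureNetwork (S : Type*) [MeasurableSpace S] where
  /-- the common law of the private signals under each hypothesis -/
  signalLaw : Bool → Measure S
  isProb : ∀ j, IsProbabilityMeasure (signalLaw j)
  /-- the prior probabilities of the two hypotheses (nonzero) -/
  prior : Bool → ℝ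
  prior_pos : ∀ j, 0 < prior j
  prior_add : prior false + prior true = 1
  /-- the memory size: node `k` observes its `memory k` immediate predecessors -/
  memory : ℕ → ℕ
  memory_le : ∀ k, memory k ≤ k
  /-- `erasureProb k j` is the probability that the broadcast of node `k` is erased,
  given that its decision is `j` -/
  erasureProb : ℕ → Bool → ℝ≥0
  erasureProb_le_one : ∀ k j, erasureProb k j ≤ 1

namespace ErasureNetwork

/-- Channel outputs: `none` is the erasure symbol `e`, `some i` is the unerased decision `i`. -/
abbrev Symbol : Type := Option Bool

/-- The broadcasts of the first `k` nodes, most recent first: entry `0` is the broadcast of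
node `k - 1`, entry `1` that of node `k - 2`, and so on. -/
abbrev History (k : ℕ) : Type := Fin k → Symbol

variable {S : Type*} [MeasurableSpace S]

/-- The likelihood ratio `dP₁ / dP₀` of a private signal. -/
noncomputable def signalLR (N : ErasureNetwork S) : S → ℝ≥0∞ :=
  (N.signalLaw true).rnDeriv (N.signalLaw false)

/-- What node `k` sees of the history: the `memory k` most recent broadcasts. -/
def observed (N : ErasureNetwork S) (k : ℕ) (h : History k) : History (N.memory k) :=
  fun i => h (Fin.castLE (N.memory_le k) i)

/-- The likelihood ratio of the broadcasts `D` observed by node `k`, when `P j` is the law of the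
whole history under hypothesis `j`. -/
noncomputable def observedLR (N : ErasureNetwork S) (k : ℕ) (P : Bool → PMF (History k))
    (D : History (N.memory k)) : ℝ≥0∞ :=
  (P true).map (N.observed k) D / (P false).map (N.observed k) D

open Classical in
/-- The likelihood ratio test with threshold `t`: decide `1` if and only if the product of the
likelihood ratio of the private signal and of that of the observed broadcasts exceeds `t`. -/
noncomputable def test (N : ErasureNetwork S) (t : ℝ) (LD : ℝ≥0∞) (s : S) : Bool :=
  decide (ENNReal.ofReal t < N.signalLR s * LD)

theorem measurable_test (N : ErasureNetwork S) (t : ℝ) (LD : ℝ≥0∞) :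
    Measurable (N.test t LD) := by
  refine measurable_to_bool ?_
  have h : N.test t LD ⁻¹' {true} = {s | ENNReal.ofReal t < N.signalLR s * LD} := by
    ext s; simp [test]
  rw [h]
  exact measurableSet_lt measurable_const
    ((Measure.measurable_rnDeriv _ _).mul measurable_const)

/-- The law, under hypothesis `j`, of the decision of node `k` given the history `h`: a private
signal is drawn from `signalLaw j`, independently of the history, and the test is applied. -/
noncomputable def decisionLaw (N : ErasureNetwork S) (t : ℝ) (k : ℕ)
    (P : Bool → PMF (History k)) (j : Bool) (h : History k) : PMF Bool :=
  haveI := N.isProb j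
  haveI : IsProbabilityMeasure
      ((N.signalLaw j).map (N.test t (N.observedLR k P (N.observed k h)))) :=
    Measure.isProbabilityMeasure_map (N.measurable_test _ _).aemeasurable
  ((N.signalLaw j).map (N.test t (N.observedLR k P (N.observed k h)))).toPMF

/-- The binary erasure channel of node `k`: the input `d` is erased with probability
`erasureProb k d` and is transmitted correctly otherwise. -/
noncomputable def channel (N : ErasureNetwork S) (k : ℕ) (d : Bool) : PMF Symbol :=
  PMF.ofFintype
    (fun x => match x with
      | none => (N.erasureProb k d : ℝ≥0∞)
      | some i => if i = d then 1 - (N.erasureProb k d : ℝ≥0∞) else 0)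
    (by
      have h : (N.erasureProb k d : ℝ≥0∞) ≤ 1 := by
        exact_mod_cast N.erasureProb_le_one k d
      rw [Fintype.sum_option]
      simp [add_tsub_cancel_of_le h])

/-- The joint law of the first `k` broadcasts under each hypothesis, when node `k` uses the
likelihood ratio test with threshold `t k`. -/
noncomputable def historyLaw (N : ErasureNetwork S) (t : ℕ → ℝ) :
    (k : ℕ) → Bool → PMF (History k)
  | 0, _ => PMF.pure Fin.elim0
  | k + 1, j =>
      (N.historyLaw t k j).bind fun h =>
        (N.decisionLaw (t k) k (N.historyLaw t k) j h).bind fun d =>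
          (N.channel k d).map fun x => (Fin.cons x h : History (k + 1))

/-- The law of the decision of node `k` under hypothesis `j`. -/
noncomputable def nodeLaw (N : ErasureNetwork S) (t : ℕ → ℝ) (k : ℕ) (j : Bool) : PMF Bool :=
  (N.historyLaw t k j).bind fun h => N.decisionLaw (t k) k (N.historyLaw t k) j h

/-- The error probability `π₀ P₀(d_k = 1) + π₁ P₁(d_k = 0)` of node `k`. -/
noncomputable def errorProb (N : ErasureNetwork S) (t : ℕ → ℝ) (k : ℕ) : ℝ :=
  N.prior false * (N.nodeLaw t k false true).toReal +
    N.prior true * (N.nodeLaw t k true false).toReal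

/-- The two laws of a private signal are equivalent measures. -/
def EquivalentSignals (N : ErasureNetwork S) : Prop :=
  N.signalLaw false ≪ N.signalLaw true ∧ N.signalLaw true ≪ N.signalLaw false

/-- The likelihood ratio of a private signal is unbounded: on every set of probability one under
`(P₀ + P₁) / 2`, its infimum is `0` and its supremum is `∞`. -/
def UnboundedSignals (N : ErasureNetwork S) : Prop :=
  ∀ S' : Set S, MeasurableSet S' →
    ((2 : ℝ≥0∞)⁻¹ • (N.signalLaw false + N.signalLaw true)) S' = 1 →
      (⨅ s ∈ S', N.signalLR s) = 0 ∧ (⨆ s ∈ S', N.signalLR s) = ∞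

open Classical in
/-- The number `n_k`: the largest `n` such that the nodes `k - n², …, k` exist and each of them
has a memory size of at least `n` (such an `n` is at most `k`, and `n = 0` qualifies). -/
noncomputable def searchLength (N : ErasureNetwork S) (k : ℕ) : ℕ :=
  Nat.findGreatest (fun n => n ^ 2 ≤ k ∧ ∀ i ∈ Finset.Icc (k - n ^ 2) k, n ≤ N.memory i) k

end ErasureNetwork

/-! All nodes use the maximum a posteriori test `bayesThreshold`. Given what a node sees, this test
errs no more than any other procedure, even a randomized one, so it suffices to bound one convenient
procedure: look back through the last `n` broadcasts, stop at the most recent one retained, and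
combine that decision with the private signal.

Erasures may depend on the decision, so where the search stops could bias the decision found.
Discarding some broadcasts at random (`retention`) makes the stopping place independent of the
decisions (`expect_searchLoss_succ`). The loss is then at most the worst error of the combining rule
over the window, plus the product of the `maxErasure i` (`errorProb_le`).

Because the signal's likelihood ratio is unbounded, the combining rule lowers an error above `δ` by
a fixed `η` (`exists_rule`). Once the product is small, each further pass gains `η / 2`, so the
errors tend to zero (`tendsto_errorProb`). The assumed bounds make the product at most a negative
power of the window length (`tendsto_prod_maxErasure`). -/

/-! ### Expectations under laws on finite types -/

namespace PMF

/-- The expectation of a real function under a probability mass function on a finite type. -/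
noncomputable def expect {α : Type*} [Fintype α] (p : PMF α) (f : α → ℝ) : ℝ :=
  ∑ a, (p a).toReal * f a

section expect

variable {α β : Type*} [Fintype α]

theorem expect_add (p : PMF α) (f g : α → ℝ) :
    p.expect (fun a => f a + g a) = p.expect f + p.expect g := by
  simp [expect, mul_add, Finset.sum_add_distrib]

theorem expect_const_mul (p : PMF α) (c : ℝ) (f : α → ℝ) :
    p.expect (fun a => c * f a) = c * p.expect f := by
  simp only [expect, Finset.mul_sum]
  exact Finset.sum_congr rfl fun a _ => by ring

theorem sum_toReal (p : PMF α) : ∑ a, (p a).toReal = 1 := by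
  rw [← ENNReal.toReal_sum fun a _ => p.apply_ne_top a, ← tsum_fintype (L := .unconditional _),
    p.tsum_coe, ENNReal.toReal_one]

theorem expect_const (p : PMF α) (c : ℝ) : p.expect (fun _ => c) = c := by
  rw [expect, ← Finset.sum_mul, sum_toReal, one_mul]

theorem expect_pure (a : α) (f : α → ℝ) : (PMF.pure a).expect f = f a := by
  classical
  rw [expect, Finset.sum_eq_single a]
  · simp
  · intro b _ hb
    simp [hb]
  · simp

theorem toReal_bind_apply (p : PMF α) (q : α → PMF β) (b : β) :
    (p.bind q b).toReal = p.expect fun a => (q a b).toReal := by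
  rw [PMF.bind_apply, tsum_fintype, ENNReal.toReal_sum]
  · simp [expect]
  · exact fun a _ => ENNReal.mul_ne_top (p.apply_ne_top a) ((q a).apply_ne_top b)

variable [Fintype β]

theorem expect_bind (p : PMF α) (q : α → PMF β) (f : β → ℝ) :
    (p.bind q).expect f = p.expect fun a => (q a).expect f := by
  simp only [expect, toReal_bind_apply, Finset.sum_mul, Finset.mul_sum]
  rw [Finset.sum_comm]
  simp only [mul_assoc]

theorem expect_map (p : PMF α) (g : α → β) (f : β → ℝ) :
    (p.map g).expect f = p.expect fun a => f (g a) := by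
  rw [← PMF.bind_pure_comp, expect_bind]
  simp only [Function.comp_apply, expect_pure]

end expect

end PMF

/-! ### Symmetrizing the erasure channel -/

namespace ErasureNetwork

variable {S : Type*} [MeasurableSpace S]

/-- The larger of the two erasure probabilities of a node. -/
noncomputable def maxErasure (N : ErasureNetwork S) (k : ℕ) : ℝ :=
  max (N.erasureProb k false : ℝ) (N.erasureProb k true : ℝ)

theorem erasureProb_le_maxErasure (N : ErasureNetwork S) (k : ℕ) (j : Bool) :
    (N.erasureProb k j : ℝ) ≤ N.maxErasure k := by
  cases j
  · exact le_max_left _ _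
  · exact le_max_right _ _

theorem maxErasure_nonneg (N : ErasureNetwork S) (k : ℕ) : 0 ≤ N.maxErasure k :=
  (N.erasureProb k false).coe_nonneg.trans (N.erasureProb_le_maxErasure k false)

theorem maxErasure_le_one (N : ErasureNetwork S) (k : ℕ) : N.maxErasure k ≤ 1 :=
  max_le (by exact_mod_cast N.erasureProb_le_one k false)
    (by exact_mod_cast N.erasureProb_le_one k true)

/-- The probability with which a receiver keeps a broadcast, chosen so that discarding the others
turns the channel into one that erases both decisions with probability `maxErasure`. -/
noncomputable def retention (N : ErasureNetwork S) (k : ℕ) : Symbol → ℝ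
  | none => 0
  | some d => (1 - N.maxErasure k) / (1 - N.erasureProb k d)

theorem retention_nonneg (N : ErasureNetwork S) (k : ℕ) (x : Symbol) : 0 ≤ N.retention k x := by
  cases x with
  | none => exact le_rfl
  | some d =>
    have h1 := N.maxErasure_le_one k
    have h2 := N.erasureProb_le_maxErasure k d
    exact div_nonneg (by linarith) (by linarith)

theorem retention_le_one (N : ErasureNetwork S) (k : ℕ) (x : Symbol) : N.retention k x ≤ 1 := by
  cases x with
  | none => exact zero_le_one
  | some d =>
    have h1 := N.maxErasure_le_one k
    have h2 := N.erasureProb_le_maxErasure k d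
    exact div_le_one_of_le₀ (by linarith) (by linarith)

theorem expect_channel (N : ErasureNetwork S) (k : ℕ) (d : Bool) (f : Symbol → ℝ) :
    (N.channel k d).expect f =
      N.erasureProb k d * f none + (1 - N.erasureProb k d) * f (some d) := by
  have h : (N.erasureProb k d : ℝ≥0∞) ≤ 1 := by exact_mod_cast N.erasureProb_le_one k d
  have h' : (1 - (N.erasureProb k d : ℝ≥0∞)).toReal = 1 - N.erasureProb k d := by
    rw [ENNReal.toReal_sub_of_le h ENNReal.one_ne_top]
    simp
  rw [PMF.expect, Fintype.sum_option]
  cases d <;> simp [channel, h']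

/-- The retention probability cancels the survival probability `1 - erasureProb k d`, so the weights
on the right no longer depend on `d`. -/
theorem expect_channel_retention (N : ErasureNetwork S) (k : ℕ) (d : Bool) (r : Symbol → ℝ)
    (u : ℝ) :
    (N.channel k d).expect (fun x => N.retention k x * r x + (1 - N.retention k x) * u) =
      (1 - N.maxErasure k) * r (some d) + N.maxErasure k * u := by
  have h1 := N.maxErasure_le_one k
  have h2 := N.erasureProb_le_maxErasure k d
  have h : (1 - (N.erasureProb k d : ℝ)) * N.retention k (some d) = 1 - N.maxErasure k := by
    -- If `d` is always erased, `retention` divides by zero, but then `maxErasure k = 1` and both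
    -- sides vanish.
    rcases eq_or_ne (1 - (N.erasureProb k d : ℝ)) 0 with h0 | h0
    · rw [h0]
      linarith
    · exact mul_div_cancel₀ _ h0
  rw [expect_channel]
  have h3 : N.retention k none = 0 := rfl
  rw [h3]
  linear_combination (r (some d) - u) * h

/-! ### Searching for the most recent retained broadcast -/

/-- A history as a sequence, with erasures at the end. -/
def pad {m : ℕ} (D : History m) (i : ℕ) : Symbol := if h : i < m then D ⟨i, h⟩ else none

theorem pad_cons_zero {m : ℕ} (x : Symbol) (D : History m) :
    pad (Fin.cons x D : History (m + 1)) 0 = x := by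
  simp only [pad, Nat.zero_lt_succ, dite_true]
  rfl

theorem pad_cons_succ {m : ℕ} (x : Symbol) (D : History m) (i : ℕ) :
    pad (Fin.cons x D : History (m + 1)) (i + 1) = pad D i := by
  by_cases h : i < m
  · simp only [pad, h, Nat.succ_lt_succ_iff, dite_true]
    rfl
  · simp [pad, h]

/-- Node `k` searches its `n` immediate predecessors for the most recent retained broadcast. The
loss is `r i x` if this is the broadcast `x` of node `i`, and `1` if there is none. -/
noncomputable def searchLoss (N : ErasureNetwork S) (r : ℕ → Symbol → ℝ) :
    ℕ → ℕ → (ℕ → Symbol) → ℝ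
  | _, 0, _ => 1
  | k, n + 1, g =>
    N.retention (k - 1) (g 0) * r (k - 1) (g 0) +
      (1 - N.retention (k - 1) (g 0)) * N.searchLoss r (k - 1) n fun i => g (i + 1)

theorem searchLoss_congr (N : ErasureNetwork S) (r : ℕ → Symbol → ℝ) (n : ℕ) :
    ∀ (k : ℕ) (g g' : ℕ → Symbol), (∀ i < n, g i = g' i) →
      N.searchLoss r k n g = N.searchLoss r k n g' := by
  induction n with
  | zero => intros; rfl
  | succ n ih =>
    intro k g g' h
    simp only [searchLoss]
    rw [h 0 n.succ_pos, ih (k - 1) _ _ fun i hi => h (i + 1) (Nat.succ_lt_succ hi)]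

theorem searchLoss_pad_observed (N : ErasureNetwork S) (r : ℕ → Symbol → ℝ) {k n : ℕ}
    (hn : n ≤ N.memory k) (h : History k) :
    N.searchLoss r k n (pad (N.observed k h)) = N.searchLoss r k n (pad h) := by
  refine N.searchLoss_congr r n k _ _ fun i hi => ?_
  have h1 : i < N.memory k := hi.trans_le hn
  have h2 : i < k := h1.trans_le (N.memory_le k)
  simp only [pad, h1, h2, dite_true]
  rfl

/-- Failing to retain the broadcast of node `k` has the same probability for both decisions. Passing
over it therefore does not tilt the law of the earlier history. -/
theorem expect_searchLoss_succ (N : ErasureNetwork S) (t : ℕ → ℝ) (r : ℕ → Symbol → ℝ)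
    (k n : ℕ) (j : Bool) :
    (N.historyLaw t (k + 1) j).expect (fun h => N.searchLoss r (k + 1) (n + 1) (pad h)) =
      (1 - N.maxErasure k) * (N.nodeLaw t k j).expect (fun d => r k (some d)) +
        N.maxErasure k * (N.historyLaw t k j).expect (fun h => N.searchLoss r k n (pad h)) := by
  simp only [historyLaw, nodeLaw, PMF.expect_bind, PMF.expect_map, searchLoss, pad_cons_zero,
    pad_cons_succ, Nat.add_sub_cancel]
  simp only [expect_channel_retention]
  simp only [PMF.expect_add, PMF.expect_const_mul, PMF.expect_const]

/-! ### Optimality of the maximum a posteriori test -/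

/-- The conditional error probability of deciding `1` exactly on `A`, under each hypothesis. -/
noncomputable def testError (N : ErasureNetwork S) (j : Bool) (A : Set S) : ℝ :=
  (N.signalLaw j).real (if j then Aᶜ else A)

theorem testError_le_one (N : ErasureNetwork S) (j : Bool) (A : Set S) : N.testError j A ≤ 1 :=
  have := N.isProb j
  measureReal_le_one

/-- The set of signals for which a test decides `1`. -/
def acceptSet (N : ErasureNetwork S) (t : ℝ) (LD : ℝ≥0∞) : Set S := N.test t LD ⁻¹' {true}

theorem measurableSet_acceptSet (N : ErasureNetwork S) (t : ℝ) (LD : ℝ≥0∞) :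
    MeasurableSet (N.acceptSet t LD) :=
  N.measurable_test t LD (measurableSet_singleton _)

theorem decisionLaw_not (N : ErasureNetwork S) (t : ℝ) (k : ℕ) (P : Bool → PMF (History k))
    (j : Bool) (h : History k) :
    (N.decisionLaw t k P j h (!j)).toReal =
      N.testError j (N.acceptSet t (N.observedLR k P (N.observed k h))) := by
  rw [decisionLaw, Measure.toPMF_apply,
    Measure.map_apply (N.measurable_test _ _) (measurableSet_singleton _)]
  cases j
  · rfl
  · simp only [testError, acceptSet, Measure.real, ← Set.preimage_compl]
    congr 3
    ext b
    cases b <;> simp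

theorem errorProb_eq_sum (N : ErasureNetwork S) (t : ℕ → ℝ) (k : ℕ) :
    N.errorProb t k = ∑ j, N.prior j * (N.nodeLaw t k j (!j)).toReal := by
  simp [errorProb, add_comm]

theorem nodeLaw_not (N : ErasureNetwork S) (t : ℕ → ℝ) (k : ℕ) (j : Bool) :
    (N.nodeLaw t k j (!j)).toReal =
      ((N.historyLaw t k j).map (N.observed k)).expect fun D =>
        N.testError j (N.acceptSet (t k) (N.observedLR k (N.historyLaw t k) D)) := by
  rw [nodeLaw, PMF.toReal_bind_apply, PMF.expect_map]
  simp only [decisionLaw_not]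

theorem lintegral_signalLR (N : ErasureNetwork S) (hac : N.signalLaw true ≪ N.signalLaw false)
    (A : Set S) :
    ∫⁻ s in A, N.signalLR s ∂(N.signalLaw false) = N.signalLaw true A := by
  have := N.isProb true
  have := N.isProb false
  exact Measure.setLIntegral_rnDeriv hac A

theorem measurable_signalLR (N : ErasureNetwork S) : Measurable N.signalLR :=
  Measure.measurable_rnDeriv _ _

/-- Pointwise optimality of the maximum a posteriori test (Neyman–Pearson). -/
theorem bayesTest_le (N : ErasureNetwork S) (hac : N.signalLaw true ≪ N.signalLaw false)
    {q₀ q₁ : ℝ≥0∞} (hq₀ : q₀ ≠ ∞) (hq₁ : q₁ ≠ ∞) {A : Set S} (hA : MeasurableSet A) :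
    N.prior false * q₀.toReal *
        N.testError false (N.acceptSet (N.prior false / N.prior true) (q₁ / q₀)) +
      N.prior true * q₁.toReal *
        N.testError true (N.acceptSet (N.prior false / N.prior true) (q₁ / q₀)) ≤
    N.prior false * q₀.toReal * N.testError false A +
      N.prior true * q₁.toReal * N.testError true A := by
  have := N.isProb true
  have := N.isProb false
  set p₀ := ENNReal.ofReal (N.prior false) with hp₀
  set p₁ := ENNReal.ofReal (N.prior true) with hp₁
  have hp₁0 : p₁ ≠ 0 := by simpa [hp₁] using N.prior_pos true
  have hp₀t : p₀ ≠ ∞ := ENNReal.ofReal_ne_top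
  have hp₁t : p₁ ≠ ∞ := ENNReal.ofReal_ne_top
  set B := N.acceptSet (N.prior false / N.prior true) (q₁ / q₀) with hBdef
  have hB : MeasurableSet B := N.measurableSet_acceptSet _ _
  have hmem : ∀ s, s ∈ B ↔ p₀ / p₁ < N.signalLR s * (q₁ / q₀) := by
    intro s
    simp [hBdef, acceptSet, test, hp₀, hp₁, ENNReal.ofReal_div_of_pos (N.prior_pos true)]
  have hin : ∀ s ∈ B, p₀ * q₀ ≤ p₁ * q₁ * N.signalLR s := by
    intro s hs
    rcases eq_or_ne q₀ 0 with h0 | h0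
    · simp [h0]
    · have h1 := ((hmem s).1 hs).le
      rw [← mul_div_assoc, ENNReal.div_le_iff hp₁0 hp₁t, ENNReal.mul_comm_div,
        ← mul_div_assoc, ENNReal.le_div_iff_mul_le (.inl h0) (.inl hq₀)] at h1
      calc p₀ * q₀ ≤ _ := h1
        _ = _ := by ring
  have hout : ∀ s ∉ B, p₁ * q₁ * N.signalLR s ≤ p₀ * q₀ := by
    intro s hs
    have h1 : N.signalLR s * (q₁ / q₀) ≤ p₀ / p₁ := not_lt.1 fun h => hs ((hmem s).2 h)
    rcases eq_or_ne q₀ 0 with h0 | h0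
    -- Here `q₁ / 0 = ∞` unless `q₁ = 0`, so a signal outside `B` must have likelihood ratio `0`.
    · rcases eq_or_ne q₁ 0 with h2 | h2
      · simp [h2]
      · rw [h0, ENNReal.div_zero h2] at h1
        rcases eq_or_ne (N.signalLR s) 0 with h3 | h3
        · simp [h3]
        · rw [ENNReal.mul_top h3, top_le_iff] at h1
          exact absurd h1 (ENNReal.div_ne_top hp₀t hp₁0)
    · rw [← mul_div_assoc, ENNReal.le_div_iff_mul_le (.inl hp₁0) (.inl hp₁t),
        ENNReal.mul_comm_div, ← mul_div_assoc, ENNReal.div_le_iff h0 hq₀] at h1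
      calc _ = _ := by ring
        _ ≤ p₀ * q₀ := h1
  have hcost : ∀ C : Set S, MeasurableSet C →
      p₀ * q₀ * N.signalLaw false C + p₁ * q₁ * N.signalLaw true Cᶜ =
        ∫⁻ s in C, p₀ * q₀ ∂(N.signalLaw false) +
          ∫⁻ s in Cᶜ, p₁ * q₁ * N.signalLR s ∂(N.signalLaw false) := by
    intro C hC
    rw [lintegral_const_mul _ N.measurable_signalLR, N.lintegral_signalLR hac,
      setLIntegral_const]
  have hmain : p₀ * q₀ * N.signalLaw false B + p₁ * q₁ * N.signalLaw true Bᶜ ≤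
      p₀ * q₀ * N.signalLaw false A + p₁ * q₁ * N.signalLaw true Aᶜ := by
    rw [hcost B hB, hcost A hA]
    -- `B` picks the smaller of the two cost densities at every signal; the integral of their
    -- minimum bounds the cost of any set from below.
    calc _ ≤ ∫⁻ s in B, min (p₀ * q₀) (p₁ * q₁ * N.signalLR s) ∂(N.signalLaw false) +
          ∫⁻ s in Bᶜ, min (p₀ * q₀) (p₁ * q₁ * N.signalLR s) ∂(N.signalLaw false) := by
          refine add_le_add (setLIntegral_mono' hB fun s hs => le_min le_rfl (hin s hs))
            (setLIntegral_mono' hB.compl fun s hs => le_min (hout s hs) le_rfl)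
      _ = ∫⁻ s in A, min (p₀ * q₀) (p₁ * q₁ * N.signalLR s) ∂(N.signalLaw false) +
          ∫⁻ s in Aᶜ, min (p₀ * q₀) (p₁ * q₁ * N.signalLR s) ∂(N.signalLaw false) := by
          rw [lintegral_add_compl _ hB, lintegral_add_compl _ hA]
      _ ≤ _ := add_le_add (lintegral_mono fun s => min_le_left _ _)
          (lintegral_mono fun s => min_le_right _ _)
  have hreal : ∀ C : Set S,
      (p₀ * q₀ * N.signalLaw false C + p₁ * q₁ * N.signalLaw true Cᶜ).toReal =
        N.prior false * q₀.toReal * N.testError false C +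
          N.prior true * q₁.toReal * N.testError true C := by
    intro C
    rw [ENNReal.toReal_add (by finiteness) (by finiteness)]
    simp [testError, Measure.real, hp₀, hp₁, ENNReal.toReal_ofReal (N.prior_pos _).le]
  rw [← hreal, ← hreal]
  exact ENNReal.toReal_mono (by finiteness) hmain

/-! ### Comparing the test with the search -/

/-- The loss, under hypothesis `j`, when `A i d` is the set of signals on which the searching node
decides `1` after having found the broadcast `d` of node `i`. -/
noncomputable def ruleLoss (N : ErasureNetwork S) (A : ℕ → Bool → Set S) (j : Bool) (i : ℕ) :
    Symbol → ℝ
  | none => 1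
  | some d => N.testError j (A i d)

/-- For fixed observations the search loss is a convex combination of errors of fixed tests and of
the trivial loss `1`. The optimal test beats each of them. -/
theorem bayesTest_le_searchLoss (N : ErasureNetwork S)
    (hac : N.signalLaw true ≪ N.signalLaw false)
    {A : ℕ → Bool → Set S} (hA : ∀ i d, MeasurableSet (A i d))
    {q₀ q₁ : ℝ≥0∞} (hq₀ : q₀ ≠ ∞) (hq₁ : q₁ ≠ ∞) (n : ℕ) :
    ∀ (k : ℕ) (g : ℕ → Symbol),
    N.prior false * q₀.toReal *
        N.testError false (N.acceptSet (N.prior false / N.prior true) (q₁ / q₀)) +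
      N.prior true * q₁.toReal *
        N.testError true (N.acceptSet (N.prior false / N.prior true) (q₁ / q₀)) ≤
    N.prior false * q₀.toReal * N.searchLoss (N.ruleLoss A false) k n g +
      N.prior true * q₁.toReal * N.searchLoss (N.ruleLoss A true) k n g := by
  have hone : ∀ j (q : ℝ≥0∞) B, N.prior j * q.toReal * N.testError j B ≤
      N.prior j * q.toReal * 1 := fun j q B =>
    mul_le_mul_of_nonneg_left (N.testError_le_one j B)
      (mul_nonneg (N.prior_pos j).le ENNReal.toReal_nonneg)
  induction n with
  | zero => exact fun k g => add_le_add (hone _ _ _) (hone _ _ _)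
  | succ n ih =>
    intro k g
    simp only [searchLoss]
    have h1 := ih (k - 1) fun i => g (i + 1)
    have h2 : N.prior false * q₀.toReal *
          N.testError false (N.acceptSet (N.prior false / N.prior true) (q₁ / q₀)) +
        N.prior true * q₁.toReal *
          N.testError true (N.acceptSet (N.prior false / N.prior true) (q₁ / q₀)) ≤
        N.prior false * q₀.toReal * N.ruleLoss A false (k - 1) (g 0) +
          N.prior true * q₁.toReal * N.ruleLoss A true (k - 1) (g 0) := by
      cases g 0 with
      | none => exact add_le_add (hone _ _ _) (hone _ _ _)
      | some d => exact N.bayesTest_le hac hq₀ hq₁ (hA _ d)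
    have h3 := mul_le_mul_of_nonneg_left h2 (N.retention_nonneg (k - 1) (g 0))
    have h4 := mul_le_mul_of_nonneg_left h1
      (sub_nonneg.2 (N.retention_le_one (k - 1) (g 0)))
    linarith

/-- The maximum a posteriori strategy. -/
noncomputable def bayesThreshold (N : ErasureNetwork S) (_ : ℕ) : ℝ :=
  N.prior false / N.prior true

theorem errorProb_le_searchLoss (N : ErasureNetwork S)
    (hac : N.signalLaw true ≪ N.signalLaw false)
    {A : ℕ → Bool → Set S} (hA : ∀ i d, MeasurableSet (A i d)) {k n : ℕ} (hn : n ≤ N.memory k) :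
    N.errorProb N.bayesThreshold k ≤
      ∑ j, N.prior j * (N.historyLaw N.bayesThreshold k j).expect
        (fun h => N.searchLoss (N.ruleLoss A j) k n (pad h)) := by
  have h : ∀ j, (N.historyLaw N.bayesThreshold k j).expect
      (fun h => N.searchLoss (N.ruleLoss A j) k n (pad h)) =
        ((N.historyLaw N.bayesThreshold k j).map (N.observed k)).expect
          (fun D => N.searchLoss (N.ruleLoss A j) k n (pad D)) := by
    intro j
    rw [PMF.expect_map]
    simp only [N.searchLoss_pad_observed _ hn]
  rw [errorProb_eq_sum]
  simp only [h, nodeLaw_not]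
  simp only [PMF.expect, Fintype.sum_bool, Finset.mul_sum]
  rw [← Finset.sum_add_distrib, ← Finset.sum_add_distrib]
  -- The comparison is made for each observation separately, with its probabilities under the two
  -- hypotheses as weights.
  refine Finset.sum_le_sum fun D _ => ?_
  have := N.bayesTest_le_searchLoss hac hA
    (q₀ := (N.historyLaw N.bayesThreshold k false).map (N.observed k) D)
    (q₁ := (N.historyLaw N.bayesThreshold k true).map (N.observed k) D)
    (PMF.apply_ne_top _ _) (PMF.apply_ne_top _ _) n k (pad D)
  simp only [observedLR, bayesThreshold] at this ⊢
  linarith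

/-- The error probability of the rule `A i` applied to the decision of node `i` itself and an
independent signal. -/
noncomputable def ruleError (N : ErasureNetwork S) (t : ℕ → ℝ) (A : ℕ → Bool → Set S) (i : ℕ) :
    ℝ :=
  ∑ j, N.prior j * (N.nodeLaw t i j).expect fun d => N.testError j (A i d)

/-- With `p = maxErasure k` and `Π` the product over the earlier nodes, the recursion gives `(1 - p)
* M + p * (M + Π) = M + p * Π`. The empty search costs `1`, the empty product. -/
theorem sum_expect_searchLoss_le (N : ErasureNetwork S) (t : ℕ → ℝ) (A : ℕ → Bool → Set S)
    {M : ℝ} (hM : 0 ≤ M) (n : ℕ) : ∀ k, n ≤ k →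
    (∀ i ∈ Finset.Ico (k - n) k, N.ruleError t A i ≤ M) →
    ∑ j, N.prior j * (N.historyLaw t k j).expect
        (fun h => N.searchLoss (N.ruleLoss A j) k n (pad h)) ≤
      M + ∏ i ∈ Finset.Ico (k - n) k, N.maxErasure i := by
  induction n with
  | zero =>
    intro k _ _
    simp only [searchLoss, PMF.expect_const, Fintype.sum_bool, Nat.sub_zero, Finset.Ico_self,
      Finset.prod_empty]
    linarith [N.prior_add]
  | succ n ih =>
    intro k hk hrule
    obtain ⟨k, rfl⟩ : ∃ l, k = l + 1 := ⟨k - 1, by omega⟩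
    rw [Nat.add_sub_add_right] at hrule ⊢
    have h1 := ih k (by omega) fun i hi => hrule i (by simp only [Finset.mem_Ico] at hi ⊢; omega)
    have h2 := hrule k (by simp)
    rw [Finset.prod_Ico_succ_top (Nat.sub_le k n)]
    simp only [expect_searchLoss_succ]
    simp only [ruleError, Fintype.sum_bool] at h1 h2 ⊢
    have h3 := mul_le_mul_of_nonneg_left h1 (N.maxErasure_nonneg k)
    have h4 := mul_le_mul_of_nonneg_left h2 (sub_nonneg.2 (N.maxErasure_le_one k))
    simp only [ruleLoss] at h3 h4 ⊢
    linarith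

theorem errorProb_le (N : ErasureNetwork S) (hac : N.signalLaw true ≪ N.signalLaw false)
    {A : ℕ → Bool → Set S} (hA : ∀ i d, MeasurableSet (A i d)) {k n : ℕ} (hn : n ≤ N.memory k)
    {M : ℝ} (hM : 0 ≤ M)
    (hrule : ∀ i ∈ Finset.Ico (k - n) k, N.ruleError N.bayesThreshold A i ≤ M) :
    N.errorProb N.bayesThreshold k ≤ M + ∏ i ∈ Finset.Ico (k - n) k, N.maxErasure i :=
  (N.errorProb_le_searchLoss hac hA hn).trans
    (N.sum_expect_searchLoss_le _ A hM n k (hn.trans (N.memory_le k)) hrule)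

theorem errorProb_nonneg (N : ErasureNetwork S) (t : ℕ → ℝ) (k : ℕ) : 0 ≤ N.errorProb t k :=
  add_nonneg (mul_nonneg (N.prior_pos _).le ENNReal.toReal_nonneg)
    (mul_nonneg (N.prior_pos _).le ENNReal.toReal_nonneg)

theorem errorProb_le_one (N : ErasureNetwork S) (t : ℕ → ℝ) (k : ℕ) : N.errorProb t k ≤ 1 := by
  have h : ∀ j b, N.prior j * (N.nodeLaw t k j b).toReal ≤ N.prior j * 1 := fun j b =>
    mul_le_mul_of_nonneg_left
      (ENNReal.toReal_le_of_le_ofReal zero_le_one (by simpa using PMF.coe_le_one _ _))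
      (N.prior_pos j).le
  have h0 := h false true
  have h1 := h true false
  rw [errorProb]
  linarith [N.prior_add]

/-! ### Improving a decision with an unbounded signal -/

theorem mix_compl_eq_one (N : ErasureNetwork S) {A : Set S} (hA : MeasurableSet A)
    (h0 : N.signalLaw false A = 0) (h1 : N.signalLaw true A = 0) :
    ((2 : ℝ≥0∞)⁻¹ • (N.signalLaw false + N.signalLaw true)) Aᶜ = 1 := by
  have := N.isProb true
  have := N.isProb false
  have e0 : N.signalLaw false Aᶜ = 1 := (prob_compl_eq_one_iff hA).2 h0
  have e1 : N.signalLaw true Aᶜ = 1 := (prob_compl_eq_one_iff hA).2 h1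
  simp only [Measure.smul_apply, Measure.add_apply, e0, e1, smul_eq_mul]
  rw [one_add_one_eq_two]
  exact ENNReal.inv_mul_cancel two_ne_zero ENNReal.ofNat_ne_top

/-- Were the set null, it would be null under both laws, and its complement would be a set of full
measure with infimum at least `τ`. -/
theorem signalLaw_lt_pos (N : ErasureNetwork S) (hequiv : N.EquivalentSignals)
    (hunbdd : N.UnboundedSignals) {τ : ℝ} (hτ : 0 < τ) :
    0 < (N.signalLaw false).real {s | N.signalLR s < ENNReal.ofReal τ} := by
  have := N.isProb false
  have hm : MeasurableSet {s | N.signalLR s < ENNReal.ofReal τ} :=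
    measurableSet_lt N.measurable_signalLR measurable_const
  refine ENNReal.toReal_pos (fun h0 => ?_) (measure_ne_top _ _)
  have h := (hunbdd _ hm.compl (N.mix_compl_eq_one hm h0 (hequiv.2 h0))).1
  have h1 : ENNReal.ofReal τ ≤
      ⨅ s ∈ {s | N.signalLR s < ENNReal.ofReal τ}ᶜ, N.signalLR s :=
    le_iInf₂ fun s hs => not_lt.1 hs
  rw [h, nonpos_iff_eq_zero, ENNReal.ofReal_eq_zero] at h1
  linarith

theorem signalLaw_gt_pos (N : ErasureNetwork S) (hequiv : N.EquivalentSignals)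
    (hunbdd : N.UnboundedSignals) (τ : ℝ) :
    0 < (N.signalLaw true).real {s | ENNReal.ofReal τ < N.signalLR s} := by
  have := N.isProb true
  have hm : MeasurableSet {s | ENNReal.ofReal τ < N.signalLR s} :=
    measurableSet_lt measurable_const N.measurable_signalLR
  refine ENNReal.toReal_pos (fun h1 => ?_) (measure_ne_top _ _)
  have h := (hunbdd _ hm.compl (N.mix_compl_eq_one hm (hequiv.1 h1) h1)).2
  have h2 : ⨆ s ∈ {s | ENNReal.ofReal τ < N.signalLR s}ᶜ, N.signalLR s ≤ ENNReal.ofReal τ :=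
    iSup₂_le fun s hs => not_lt.1 hs
  rw [h, top_le_iff] at h2
  exact ENNReal.ofReal_ne_top h2

theorem signalLaw_lt_le (N : ErasureNetwork S) (hac : N.signalLaw true ≪ N.signalLaw false)
    {τ : ℝ} (hτ : 0 ≤ τ) :
    (N.signalLaw true).real {s | N.signalLR s < ENNReal.ofReal τ} ≤
      τ * (N.signalLaw false).real {s | N.signalLR s < ENNReal.ofReal τ} := by
  have := N.isProb false
  have hm : MeasurableSet {s | N.signalLR s < ENNReal.ofReal τ} :=
    measurableSet_lt N.measurable_signalLR measurable_const
  have h : N.signalLaw true {s | N.signalLR s < ENNReal.ofReal τ} ≤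
      ENNReal.ofReal τ * N.signalLaw false {s | N.signalLR s < ENNReal.ofReal τ} := by
    rw [← N.lintegral_signalLR hac, ← setLIntegral_const]
    exact setLIntegral_mono' hm fun s hs => le_of_lt hs
  simpa [Measure.real, ENNReal.toReal_ofReal hτ] using ENNReal.toReal_mono (by finiteness) h

theorem le_signalLaw_gt (N : ErasureNetwork S) (hac : N.signalLaw true ≪ N.signalLaw false)
    {τ : ℝ} (hτ : 0 ≤ τ) :
    τ * (N.signalLaw false).real {s | ENNReal.ofReal τ < N.signalLR s} ≤
      (N.signalLaw true).real {s | ENNReal.ofReal τ < N.signalLR s} := by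
  have := N.isProb true
  have hm : MeasurableSet {s | ENNReal.ofReal τ < N.signalLR s} :=
    measurableSet_lt measurable_const N.measurable_signalLR
  have h : ENNReal.ofReal τ * N.signalLaw false {s | ENNReal.ofReal τ < N.signalLR s} ≤
      N.signalLaw true {s | ENNReal.ofReal τ < N.signalLR s} := by
    rw [← N.lintegral_signalLR hac, ← setLIntegral_const]
    exact setLIntegral_mono' hm fun s hs => le_of_lt hs
  simpa [Measure.real, ENNReal.toReal_ofReal hτ] using ENNReal.toReal_mono (by finiteness) h

/-- An independent signal with unbounded likelihood ratio improves on a binary decision by an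
amount that is bounded below as long as the error probability is. -/
theorem exists_rule (N : ErasureNetwork S) (hequiv : N.EquivalentSignals)
    (hunbdd : N.UnboundedSignals) {δ : ℝ} (hδ : 0 < δ) :
    ∃ η > 0, ∀ α β : ℝ, 0 ≤ α → α ≤ 1 → 0 ≤ β → β ≤ 1 →
      ∃ A : Bool → Set S, (∀ d, MeasurableSet (A d)) ∧
        N.prior false * (α * N.testError false (A true) +
            (1 - α) * N.testError false (A false)) +
          N.prior true * ((1 - β) * N.testError true (A true) +
            β * N.testError true (A false)) ≤
        max δ (N.prior false * α + N.prior true * β - η) := by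
  have := N.isProb false
  have := N.isProb true
  have hlo := N.signalLaw_lt_pos hequiv hunbdd (τ := δ / 4) (by positivity)
  have hhi := N.signalLaw_gt_pos hequiv hunbdd (4 / δ)
  have hlo' := N.signalLaw_lt_le hequiv.2 (τ := δ / 4) (by positivity)
  have hhi' := N.le_signalLaw_gt hequiv.2 (τ := 4 / δ) (by positivity)
  set A₀ := {s | N.signalLR s < ENNReal.ofReal (δ / 4)} with hA₀
  set A₁ := {s | ENNReal.ofReal (4 / δ) < N.signalLR s} with hA₁
  have hm₀ : MeasurableSet A₀ := measurableSet_lt N.measurable_signalLR measurable_const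
  have hm₁ : MeasurableSet A₁ := measurableSet_lt measurable_const N.measurable_signalLR
  set x₀ := (N.signalLaw false).real A₀
  set x₁ := (N.signalLaw true).real A₀
  set y₀ := (N.signalLaw false).real A₁
  set y₁ := (N.signalLaw true).real A₁
  have hp₀ := N.prior_pos false
  have hp₁ := N.prior_pos true
  have hp := N.prior_add
  refine ⟨min (x₀ * (δ / 4)) (y₁ * (δ / 4)), by positivity, fun α β hα0 hα1 hβ0 hβ1 => ?_⟩
  have hmin₀ := min_le_left (x₀ * (δ / 4)) (y₁ * (δ / 4))
  have hmin₁ := min_le_right (x₀ * (δ / 4)) (y₁ * (δ / 4))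
  rcases lt_or_ge (N.prior false * α + N.prior true * β) δ with he | he
  -- The error is already below `δ`: copy the decision.
  · refine ⟨fun d => if d then Set.univ else ∅, fun d => ?_, le_max_of_le_left ?_⟩
    · cases d <;> simp
    · simp [testError]
      linarith
  · rcases le_total (δ / 2) (N.prior false * α) with ha | ha
    -- Overturn a decision `1` when the signal lies in `A₀`. This gains at least `δ / 2 * x₀` under
    -- the first hypothesis and costs at most `x₁ ≤ δ / 4 * x₀` under the second.
    · refine ⟨fun d => if d then A₀ᶜ else ∅, fun d => ?_, le_max_of_le_right ?_⟩
      · cases d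
        · simp
        · simpa using hm₀
      · have e₀ : N.testError false A₀ᶜ = 1 - x₀ := probReal_compl_eq_one_sub hm₀
        have e₁ : N.testError true A₀ᶜ = x₁ := by simp [testError, x₁]
        have e₂ : N.testError false (∅ : Set S) = 0 := by simp [testError]
        have e₃ : N.testError true (∅ : Set S) = 1 := by simp [testError]
        simp only [if_true, Bool.false_eq_true, if_false, e₀, e₁, e₂, e₃]
        have h1 : N.prior true * (1 - β) * x₁ ≤ 1 * (δ / 4 * x₀) := by
          refine mul_le_mul ?_ hlo' measureReal_nonneg zero_le_one
          nlinarith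
        have h2 : δ / 2 * x₀ ≤ N.prior false * α * x₀ :=
          mul_le_mul_of_nonneg_right ha hlo.le
        linarith
    · have hb : δ / 2 ≤ N.prior true * β := by linarith
      -- The mirror image: overturn a decision `0` on `A₁`, for a net gain of at least `δ / 4 * y₁`.
      refine ⟨fun d => if d then Set.univ else A₁, fun d => ?_, le_max_of_le_right ?_⟩
      · cases d
        · simpa using hm₁
        · simp
      · have e₀ : N.testError false A₁ = y₀ := rfl
        have e₁ : N.testError true A₁ = 1 - y₁ := probReal_compl_eq_one_sub hm₁
        have e₂ : N.testError false (Set.univ : Set S) = 1 := by simp [testError]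
        have e₃ : N.testError true (Set.univ : Set S) = 0 := by simp [testError]
        simp only [if_true, Bool.false_eq_true, if_false, e₀, e₁, e₂, e₃]
        have hy : y₀ ≤ δ / 4 * y₁ := by
          have := mul_le_mul_of_nonneg_left hhi' (show 0 ≤ δ / 4 by positivity)
          calc y₀ = δ / 4 * (4 / δ * y₀) := by field_simp
            _ ≤ _ := this
        have h1 : N.prior false * (1 - α) * y₀ ≤ 1 * (δ / 4 * y₁) := by
          refine mul_le_mul ?_ hy measureReal_nonneg zero_le_one
          nlinarith
        have h2 : δ / 2 * y₁ ≤ N.prior true * β * y₁ :=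
          mul_le_mul_of_nonneg_right hb hhi.le
        linarith

theorem exists_rule_ruleError_le (N : ErasureNetwork S) (hequiv : N.EquivalentSignals)
    (hunbdd : N.UnboundedSignals) (t : ℕ → ℝ) {δ : ℝ} (hδ : 0 < δ) :
    ∃ η > 0, ∃ A : ℕ → Bool → Set S, (∀ i d, MeasurableSet (A i d)) ∧
      ∀ i, N.ruleError t A i ≤ max δ (N.errorProb t i - η) := by
  obtain ⟨η, hη, h⟩ := N.exists_rule hequiv hunbdd hδ
  have hle : ∀ i j b, (N.nodeLaw t i j b).toReal ≤ 1 := fun i j b =>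
    ENNReal.toReal_le_of_le_ofReal zero_le_one (by simpa using PMF.coe_le_one _ _)
  choose A hA hA' using fun i => h (N.nodeLaw t i false true).toReal
    (N.nodeLaw t i true false).toReal ENNReal.toReal_nonneg (hle _ _ _) ENNReal.toReal_nonneg
    (hle _ _ _)
  refine ⟨η, hη, A, hA, fun i => ?_⟩
  have h0 := (N.nodeLaw t i false).sum_toReal
  have h1 := (N.nodeLaw t i true).sum_toReal
  rw [Fintype.sum_bool] at h0 h1
  have e0 : (N.nodeLaw t i false false).toReal = 1 - (N.nodeLaw t i false true).toReal := by
    linarith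
  have e1 : (N.nodeLaw t i true true).toReal = 1 - (N.nodeLaw t i true false).toReal := by
    linarith
  refine le_trans (le_of_eq ?_) (hA' i)
  simp only [ruleError, PMF.expect, Fintype.sum_bool, e0, e1]
  ring

/-! ### Convergence of the error probabilities -/

/-- Learning under the maximum a posteriori strategy, when the probability that a whole search
window is erased tends to zero and the windows move to infinity. -/
theorem tendsto_errorProb (N : ErasureNetwork S) (hequiv : N.EquivalentSignals)
    (hunbdd : N.UnboundedSignals) {n : ℕ → ℕ} (hn : ∀ k, n k ≤ N.memory k)
    (hstart : Tendsto (fun k => k - n k) atTop atTop)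
    (hprod : Tendsto (fun k => ∏ i ∈ Finset.Ico (k - n k) k, N.maxErasure i) atTop (𝓝 0)) :
    Tendsto (N.errorProb N.bayesThreshold) atTop (𝓝 0) := by
  have key : ∀ δ > 0, ∀ᶠ k in atTop, N.errorProb N.bayesThreshold k ≤ 2 * δ := by
    intro δ hδ
    obtain ⟨η, hη, A, hA, hrule⟩ :=
      N.exists_rule_ruleError_le hequiv hunbdd N.bayesThreshold hδ
    have step : ∀ r : ℕ, ∀ᶠ k in atTop,
        N.errorProb N.bayesThreshold k ≤ max (2 * δ) (1 - r * (η / 2)) := by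
      intro r
      induction r with
      | zero => exact .of_forall fun k => le_max_of_le_right (by simpa using N.errorProb_le_one _ k)
      | succ r ih =>
        obtain ⟨k₀, hk₀⟩ := eventually_atTop.1 ih
        filter_upwards [hstart.eventually_ge_atTop k₀,
          -- The product must fit in the slack between `δ` and `2 * δ`, and may spend only half of
          -- the gain `η`.
          hprod.eventually_le_const (show (0 : ℝ) < min δ (η / 2) by positivity)] with k hk hk'
        have h := N.errorProb_le hequiv.2 hA (hn k)
          (M := max δ (max (2 * δ) (1 - r * (η / 2)) - η)) (le_max_of_le_left hδ.le)
          fun i hi => (hrule i).trans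
            (max_le_max le_rfl (sub_le_sub_right (hk₀ i (hk.trans (Finset.mem_Ico.1 hi).1)) η))
        refine (h.trans (add_le_add_right hk' _)).trans ?_
        have h1 := min_le_left δ (η / 2)
        have h2 := min_le_right δ (η / 2)
        push_cast
        rcases max_cases δ (max (2 * δ) (1 - r * (η / 2)) - η) with ⟨e, _⟩ | ⟨e, _⟩
        · exact le_max_of_le_left (by linarith)
        · rcases max_cases (2 * δ) (1 - r * (η / 2)) with ⟨e', _⟩ | ⟨e', _⟩
          · exact le_max_of_le_left (by linarith)
          · exact le_max_of_le_right (by linarith)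
    obtain ⟨r, hr⟩ := exists_nat_ge (1 / (η / 2))
    have hr' : 1 ≤ r * (η / 2) := (div_le_iff₀ (by positivity)).1 hr
    filter_upwards [step r] with k hk
    exact hk.trans (max_le le_rfl (by linarith))
  refine Metric.tendsto_atTop.2 fun ρ hρ => ?_
  obtain ⟨k₀, hk₀⟩ := eventually_atTop.1 (key (ρ / 4) (by positivity))
  refine ⟨k₀, fun k hk => ?_⟩
  rw [Real.dist_eq, sub_zero, abs_of_nonneg (N.errorProb_nonneg _ k)]
  linarith [hk₀ k hk]

/-! ### Search windows and the erasure bound -/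

theorem searchLength_spec (N : ErasureNetwork S) (k : ℕ) :
    N.searchLength k ^ 2 ≤ k ∧
      ∀ i ∈ Finset.Icc (k - N.searchLength k ^ 2) k, N.searchLength k ≤ N.memory i := by
  classical
  exact Nat.findGreatest_spec
    (P := fun n => n ^ 2 ≤ k ∧ ∀ i ∈ Finset.Icc (k - n ^ 2) k, n ≤ N.memory i)
    (Nat.zero_le k) ⟨by simp, fun i _ => Nat.zero_le _⟩

theorem searchLength_le_memory (N : ErasureNetwork S) (k : ℕ) :
    N.searchLength k ≤ N.memory k :=
  (N.searchLength_spec k).2 k (by simp)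

theorem tendsto_searchLength (N : ErasureNetwork S) (hmem : Tendsto N.memory atTop atTop) :
    Tendsto N.searchLength atTop atTop := by
  refine tendsto_atTop.2 fun n => ?_
  obtain ⟨k₀, hk₀⟩ := eventually_atTop.1 (hmem.eventually_ge_atTop n)
  filter_upwards [eventually_ge_atTop (k₀ + n ^ 2)] with k hk
  have h : n ≤ n ^ 2 := Nat.le_self_pow two_ne_zero n
  classical
  refine Nat.le_findGreatest (by omega) ⟨by omega, fun i hi => hk₀ i ?_⟩
  have := (Finset.mem_Icc.1 hi).1
  omega

/-- Since the square of the window length is at most `k`, the window covers at most half of the past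
once its length exceeds `2`. -/
theorem tendsto_sub_searchLength (N : ErasureNetwork S) :
    Tendsto (fun k => k - N.searchLength k) atTop atTop := by
  refine tendsto_atTop.2 fun b => ?_
  filter_upwards [eventually_ge_atTop (2 * b + 2)] with k hk
  have h := (N.searchLength_spec k).1
  rcases le_or_gt (N.searchLength k) 2 with h2 | h2
  · omega
  · have : 2 * N.searchLength k ≤ N.searchLength k ^ 2 := by nlinarith
    omega

theorem maxErasure_le (N : ErasureNetwork S) {k : ℕ} {b : ℝ}
    (h : ∀ j, (N.erasureProb k j : ℝ) ≤ b) : N.maxErasure k ≤ b :=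
  max_le (h false) (h true)

/-- If every erasure probability in the windows is at most `(c n) ^ (-ε / n)`, where `n` is the
window length, then the probability that the whole window is erased tends to zero. -/
theorem tendsto_prod_maxErasure (N : ErasureNetwork S) {n : ℕ → ℕ} (hnk : ∀ k, n k ≤ k)
    (hn : Tendsto n atTop atTop) {ε c : ℝ} (hε : 0 < ε) (hc : 0 < c)
    (hbound : ∀ᶠ k in atTop, ∀ i ∈ Finset.Ico (k - n k) k,
      N.maxErasure i ≤ (c * n k) ^ (-ε / (n k : ℝ))) :
    Tendsto (fun k => ∏ i ∈ Finset.Ico (k - n k) k, N.maxErasure i) atTop (𝓝 0) := by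
  have hlim : Tendsto (fun k => (c * (n k : ℝ)) ^ (-ε)) atTop (𝓝 0) :=
    (tendsto_rpow_neg_atTop hε).comp
      ((tendsto_natCast_atTop_atTop.comp hn).const_mul_atTop hc)
  refine squeeze_zero' (.of_forall fun k => Finset.prod_nonneg fun i _ => N.maxErasure_nonneg i)
    ?_ hlim
  filter_upwards [hbound, hn.eventually_ge_atTop 1] with k hk hk1
  have hpos : (0 : ℝ) < n k := by exact_mod_cast hk1
  calc _ ≤ ∏ i ∈ Finset.Ico (k - n k) k, (c * (n k : ℝ)) ^ (-ε / (n k : ℝ)) :=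
        Finset.prod_le_prod (fun i _ => N.maxErasure_nonneg i) hk
    _ = (c * (n k : ℝ)) ^ (-ε) := by
        rw [Finset.prod_const, Nat.card_Ico, Nat.sub_sub_self (hnk k), ← Real.rpow_natCast,
          ← Real.rpow_mul (by positivity), div_mul_cancel₀ _ hpos.ne']

/-- The bound `(c x) ^ (-ε / x)` is increasing in `x` from `e / c` on. -/
theorem rpow_neg_div_le {ε c x y : ℝ} (hε : 0 ≤ ε) (hc : 0 < c) (hx : Real.exp 1 ≤ c * x)
    (hxy : x ≤ y) : (c * x) ^ (-ε / x) ≤ (c * y) ^ (-ε / y) := by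
  have hcx : 0 < c * x := (Real.exp_pos 1).trans_le hx
  have hx0 : 0 < x := pos_of_mul_pos_right hcx hc.le
  have hcxy : c * x ≤ c * y := mul_le_mul_of_nonneg_left hxy hc.le
  rw [Real.rpow_def_of_pos hcx, Real.rpow_def_of_pos (hcx.trans_le hcxy), Real.exp_le_exp]
  have h : Real.log (c * y) / (c * y) ≤ Real.log (c * x) / (c * x) :=
    Real.log_div_self_antitoneOn hx (hx.trans hcxy) hcxy
  have h2 := mul_le_mul_of_nonneg_left h (mul_nonneg hε hc.le)
  have e : ∀ z : ℝ, Real.log (c * z) * (-ε / z) =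
      -(ε * c * (Real.log (c * z) / (c * z))) := by
    intro z
    rcases eq_or_ne z 0 with rfl | hz
    · simp
    · field_simp
  rw [e, e]
  linarith

end ErasureNetwork

theorem theorem3 {S : Type*} [MeasurableSpace S] (N : ErasureNetwork S)
    (hequiv : N.EquivalentSignals) (hunbdd : N.UnboundedSignals)
    (hmem : Tendsto N.memory atTop atTop)
    (ε c : ℝ) (hε : 1 < ε) (hc : 0 < c)
    (hbound :
      (∀ᶠ k in atTop, ∀ i ∈ Finset.Ico (k - N.searchLength k) k, ∀ j,
        (N.erasureProb i j : ℝ) ≤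
          (c * (N.searchLength k : ℝ)) ^ (-ε / (N.searchLength k : ℝ))) ∨
      ((∀ᶠ k in atTop, ∀ j,
        (N.erasureProb k j : ℝ) ≤
          (c * (N.searchLength k : ℝ)) ^ (-ε / (N.searchLength k : ℝ))) ∧
        ∃ K : ℝ, ∀ᶠ k in atTop, ∀ i ∈ Finset.Ico (k - N.searchLength k) k,
          (N.searchLength i : ℝ) ≤ K * (N.searchLength k : ℝ))) :
    ∃ t : ℕ → ℝ, (∀ k, 0 < t k) ∧ Tendsto (N.errorProb t) atTop (𝓝 0) := by
  have hle : ∀ k, N.searchLength k ≤ k := fun k =>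
    (N.searchLength_le_memory k).trans (N.memory_le k)
  have hn := N.tendsto_searchLength hmem
  refine ⟨N.bayesThreshold, fun k => div_pos (N.prior_pos _) (N.prior_pos _),
    N.tendsto_errorProb hequiv hunbdd N.searchLength_le_memory N.tendsto_sub_searchLength ?_⟩
  rcases hbound with h | ⟨h, K, hK⟩
  · refine N.tendsto_prod_maxErasure hle hn (zero_lt_one.trans hε) hc ?_
    filter_upwards [h] with k hk i hi
    exact N.maxErasure_le (hk i hi)
  · have hK₁ : 0 < max K 1 := zero_lt_one.trans_le (le_max_right _ _)
    -- By monotonicity, the bound at node `i` is at most its value at length `max K 1 * searchLength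
    -- k`. Absorbing the factor into the constants restores the form of the first case; the maximum
    -- with `1` keeps them positive.
    refine N.tendsto_prod_maxErasure hle hn (ε := ε / max K 1) (c := c * max K 1)
      (div_pos (zero_lt_one.trans hε) hK₁) (mul_pos hc hK₁) ?_
    have hlarge : ∀ᶠ i in atTop, Real.exp 1 ≤ c * (N.searchLength i : ℝ) :=
      ((tendsto_natCast_atTop_atTop.comp hn).const_mul_atTop hc).eventually_ge_atTop _
    obtain ⟨k₀, hk₀⟩ := eventually_atTop.1 (h.and hlarge)
    filter_upwards [hK, N.tendsto_sub_searchLength.eventually_ge_atTop k₀] with k hk hk' i hi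
    obtain ⟨hp, hl⟩ := hk₀ i (hk'.trans (Finset.mem_Ico.1 hi).1)
    have hik : (N.searchLength i : ℝ) ≤ max K 1 * N.searchLength k :=
      (hk i hi).trans (mul_le_mul_of_nonneg_right (le_max_left _ _) (Nat.cast_nonneg _))
    refine (N.maxErasure_le hp).trans
      ((ErasureNetwork.rpow_neg_div_le (zero_le_one.trans hε.le) hc hl hik).trans (le_of_eq ?_))
    rw [mul_assoc, neg_div, neg_div, div_div]
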